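/- Let $\Bbbk$ be an algebraically closed field of characteristic zero and let $n\ge 1$. Let $V=\Bbbk^{2n+1}$ have basis $e_1,\dots,e_n,e,e'_n,\dots,e'_1$ and carry the symmetric bilinear form with $(e_i,e'_i)=(e'_i,e_i)=1$, $(e,e)=1$ and all other pairings of basis vectors equal to zero. Let $\mathrm{SO}_{2n+1}$ be the group of isometries of $V$ of determinant one, let $\mathrm{SO}_{2n}\subset \mathrm{SO}_{2n+1}$ be the special orthogonal group of $\langle e_1,\dots,e_n,e'_n,\dots,e'_1\rangle$, extended by the identity on $e$, and let $T\subset \mathrm{SO}_{2n+1}$ be the maximal torus of diagonal matrices $\mathrm{diag}(t_1,\dots,t_n,1,t_n^{-1},\dots,t_1^{-1})$. Let ${}^{T}\Bbbk[\mathrm{SO}_{2n+1}]^{\mathrm{SO}_{2n}}$ be the algebra of regular functions on $\mathrm{SO}_{2n+1}$ that are invariant under the action $(t,h)\circ g=tgh^{-1}$ of $T\times \mathrm{SO}_{2n}$. Then: (1) The algebra ${}^{T}\Bbbk[\mathrm{SO}_{2n+1}]^{\mathrm{SO}_{2n}}$ is free, that is, isomorphic to a polynomial algebra over $\Bbbk$;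 the number of generators is $n$. (2) Let $Z\subset\Bbbk^{2n+1}$ be the quadric $\sum_{i=1}^n x_ix'_i+x^2=1$, on which $t\in T$ acts by $x_i\mapsto t_ix_i$, $x'_i\mapsto t_i^{-1}x'_i$, $x\mapsto x$. The map $\mathrm{SO}_{2n+1}\to Z$, $g\mapsto (x_i,x,x'_i)=(2(ge)_i,(ge)_0,(ge)'_i)$, where $ge=\sum_i (ge)_ie_i+(ge)_0e+\sum_i(ge)'_ie'_i$, is a $T$-equivariant surjective morphism whose fibres are the cosets $g\,\mathrm{SO}_{2n}$, and pulling functions back along it gives isomorphisms $\Bbbk[Z]\cong\Bbbk[\mathrm{SO}_{2n+1}]^{\mathrm{SO}_{2n}}$ and $\Bbbk[Z]^T\cong{}^{T}\Bbbk[\mathrm{SO}_{2n+1}]^{\mathrm{SO}_{2n}}$. Thus $\mathrm{SO}_{2n+1}/\mathrm{SO}_{2n}\cong Z$, and the double coset variety $\operatorname{Spec}{}^{T}\Bbbk[\mathrm{SO}_{2n+1}]^{\mathrm{SO}_{2n}}$ is the quotient $Z/\!/T=\operatorname{Spec}\Bbbk[Z]^T$. (3) Let $Y\subset\Bbbk^{n+1}$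 be the hypersurface $z_1+\dots+z_n+x^2=1$. Pulling functions back along $Z\to Y$, $z_i=x_ix'_i$, $x=x$, gives an isomorphism $\Bbbk[Y]\cong\Bbbk[Z]^T$; thus $Z/\!/T\cong Y$. The hypersurface $Y$ is a cylinder over a parabola: some linear isomorphism $\Bbbk^{n+1}\to\Bbbk^2\times\Bbbk^{n-1}$ takes $Y$ onto $\{(z,x): z+x^2=1\}\times\Bbbk^{n-1}$. Hence $Y$ is isomorphic, as an affine variety, to the affine space $\mathbb A^n$. -/

import Mathlib

open Matrix

noncomputable section

/-! ### Algebras of regular functions -/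

/-- The algebra of regular functions on a set `X` with coordinate map `c : X → 𝔸^σ`: the functions
`X → k` that are polynomials in the coordinates. When `k` is algebraically closed and `c` identifies
`X` with a Zariski closed subset of `𝔸^σ`, this is the coordinate ring `k[X]`. -/
def regularFunctions (k : Type*) [Field k] {X σ : Type*} (c : X → σ → k) :
    Subalgebra k (X → k) :=
  (MvPolynomial.aeval (fun (i : σ) (x : X) => c x i) : MvPolynomial σ k →ₐ[k] (X → k)).range

/-- The subalgebra of those functions in `A` that are invariant under all the transformations
`act s : X → X`. -/
def invariantFunctions {k : Type*} [Field k] {X S : Type*} (A : Subalgebra k (X → k))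
    (act : S → X → X) : Subalgebra k (X → k) where
  carrier := {f | f ∈ A ∧ ∀ s x, f (act s x) = f x}
  mul_mem' := fun {f g} hf hg =>
    ⟨A.mul_mem hf.1 hg.1, fun s x => by rw [Pi.mul_apply, Pi.mul_apply, hf.2 s x, hg.2 s x]⟩
  add_mem' := fun {f g} hf hg =>
    ⟨A.add_mem hf.1 hg.1, fun s x => by rw [Pi.add_apply, Pi.add_apply, hf.2 s x, hg.2 s x]⟩
  algebraMap_mem' := fun r => ⟨A.algebraMap_mem r, fun _ _ => rfl⟩

/-- The map `π : X → Y` identifies, by pulling functions back along it, the algebra `B` of functions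
on `Y` with the algebra `A` of functions on `X`. If `B = k[Y]` and `A` is the algebra of invariants
of a reductive group acting on the affine variety `X`, then this says that `π` is the
categorical quotient. -/
def PullbackIso {k : Type*} [Field k] {X Y : Type*} (π : X → Y) (B : Subalgebra k (Y → k))
    (A : Subalgebra k (X → k)) : Prop :=
  ∃ φ : B ≃ₐ[k] A, ∀ (f : B) (x : X), (φ f : X → k) x = (f : Y → k) (π x)

/-! ### Special orthogonal groups -/

/-- The group of isometries of determinant one of the bilinear form with Gram matrix `J`. -/
def specialOrthogonal {k : Type*} [Field k] {ι : Type*} [Fintype ι] [DecidableEq ι]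
    (J : Matrix ι ι k) : Subgroup (SpecialLinearGroup ι k) where
  carrier := {A | (A : Matrix ι ι k)ᵀ * J * (A : Matrix ι ι k) = J}
  one_mem' := by
    change (1 : Matrix ι ι k)ᵀ * J * (1 : Matrix ι ι k) = J
    simp
  mul_mem' := by
    rintro ⟨A, dA⟩ ⟨B, dB⟩ (hA : Aᵀ * J * A = J) (hB : Bᵀ * J * B = J)
    change (A * B)ᵀ * J * (A * B) = J
    calc (A * B)ᵀ * J * (A * B) = Bᵀ * (Aᵀ * J * A) * B := by
          simp only [transpose_mul, Matrix.mul_assoc]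
      _ = J := by rw [hA, hB]
  inv_mem' := by
    rintro ⟨A, dA⟩ (hA : Aᵀ * J * A = J)
    change (adjugate A)ᵀ * J * adjugate A = J
    have h1 : A * adjugate A = 1 := by rw [mul_adjugate, dA, one_smul]
    have h2 : (adjugate A)ᵀ * Aᵀ = 1 := by rw [← transpose_mul, h1, transpose_one]
    calc (adjugate A)ᵀ * J * adjugate A = (adjugate A)ᵀ * (Aᵀ * J * A) * adjugate A := by rw [hA]
      _ = ((adjugate A)ᵀ * Aᵀ) * J * (A * adjugate A) := by simp only [Matrix.mul_assoc]
      _ = J := by rw [h1, h2, Matrix.one_mul, Matrix.mul_one]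

/-- Indices of the basis `e₁, …, eₙ, e'₁, …, e'ₙ` of `k^{2n}`: `inl i` stands for `eᵢ` and `inr i`
for `e'ᵢ`. -/
abbrev EvenIndex (n : ℕ) : Type := Fin n ⊕ Fin n

/-- Indices of the basis of `k^{2n+1} = k^{2n} ⊕ k e`. -/
abbrev OddIndex (n : ℕ) : Type := EvenIndex n ⊕ Unit

/-- The Gram matrix of the form on `k^{2n}` with `(eᵢ, e'ᵢ) = (e'ᵢ, eᵢ) = 1` and all other pairings
of basis vectors zero. -/
def evenForm (k : Type*) [Field k] (n : ℕ) : Matrix (EvenIndex n) (EvenIndex n) k :=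
  fromBlocks 0 1 1 0

/-- The Gram matrix of the orthogonal direct sum of `k^{2n}` and `k e`, where `(e, e) = 1`. -/
def oddForm (k : Type*) [Field k] (n : ℕ) : Matrix (OddIndex n) (OddIndex n) k :=
  fromBlocks (evenForm k n) 0 0 1

/-- `SO_{2n}`. -/
abbrev SOEven (k : Type*) [Field k] (n : ℕ) : Subgroup (SpecialLinearGroup (EvenIndex n) k) :=
  specialOrthogonal (evenForm k n)

/-- `SO_{2n+1}`. -/
abbrev SOOdd (k : Type*) [Field k] (n : ℕ) : Subgroup (SpecialLinearGroup (OddIndex n) k) :=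
  specialOrthogonal (oddForm k n)

/-- The matrix of an element of `SO_{2n+1}`. -/
abbrev soMat {k : Type*} [Field k] {n : ℕ} (g : SOOdd k n) :
    Matrix (OddIndex n) (OddIndex n) k :=
  ((g : SpecialLinearGroup (OddIndex n) k) : Matrix (OddIndex n) (OddIndex n) k)

/-- The standard embedding `SO_{2n} → SO_{2n+1}`, `A ↦ A ⊕ 1`. -/
def soEmbedding (k : Type*) [Field k] (n : ℕ) : SOEven k n →* SOOdd k n where
  toFun A := ⟨⟨fromBlocks (A : SpecialLinearGroup (EvenIndex n) k).1 0 0 1, by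
      rw [det_fromBlocks_zero₂₁, det_one, mul_one]
      exact (A : SpecialLinearGroup (EvenIndex n) k).2⟩, by
    have h : ((A : SpecialLinearGroup (EvenIndex n) k).1)ᵀ * evenForm k n *
        (A : SpecialLinearGroup (EvenIndex n) k).1 = evenForm k n := A.2
    change (fromBlocks _ 0 0 1)ᵀ * oddForm k n * fromBlocks _ 0 0 1 = oddForm k n
    simp [oddForm, fromBlocks_transpose, fromBlocks_multiply, h]⟩
  map_one' := by
    apply Subtype.ext
    apply Subtype.ext
    simp
  map_mul' A B := by
    apply Subtype.ext
    apply Subtype.ext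
    change fromBlocks ((A : SpecialLinearGroup (EvenIndex n) k).1 *
      (B : SpecialLinearGroup (EvenIndex n) k).1) 0 0 1 = fromBlocks _ 0 0 1 * fromBlocks _ 0 0 1
    simp [fromBlocks_multiply]

/-- The subgroup `H = SO_{2n}` of `G = SO_{2n+1}`. -/
def soSubgroup (k : Type*) [Field k] (n : ℕ) : Subgroup (SOOdd k n) := (soEmbedding k n).range

/-- The diagonal entries of `diag(t₁, …, tₙ, 1, tₙ⁻¹, …, t₁⁻¹)`. -/
def torusDiag {k : Type*} [Field k] {n : ℕ} (t : Fin n → kˣ) : OddIndex n → k :=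
  Sum.elim (Sum.elim (fun i => (t i : k)) (fun i => ((t i)⁻¹ : kˣ))) (fun _ => 1)

/-- The homomorphism `(kˣ)ⁿ → SO_{2n+1}`, `t ↦ diag(t₁, …, tₙ, 1, tₙ⁻¹, …, t₁⁻¹)`. -/
def torusHom (k : Type*) [Field k] (n : ℕ) : (Fin n → kˣ) →* SOOdd k n where
  toFun t := ⟨⟨diagonal (torusDiag t), by
      have h : (∏ i, (t i : k)) ≠ 0 := Finset.prod_ne_zero_iff.2 fun i _ => (t i).ne_zero
      simp [det_diagonal, torusDiag, Fintype.prod_sum_type, mul_inv_cancel₀ h]⟩, by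
    change (diagonal (torusDiag t))ᵀ * oddForm k n * diagonal (torusDiag t) = oddForm k n
    ext a b
    rw [diagonal_transpose, mul_diagonal, diagonal_mul]
    rcases a with (i | i) | i <;> rcases b with (j | j) | j <;>
      simp [oddForm, evenForm, torusDiag, Matrix.one_apply]
    all_goals
      split_ifs with h
      · subst h
        simp
      · rfl⟩
  map_one' := by
    apply Subtype.ext
    apply Subtype.ext
    ext a b
    rcases a with (i | i) | i <;> rcases b with (j | j) | j <;>
      simp [torusDiag, diagonal_apply, Matrix.one_apply]
  map_mul' s t := by
    apply Subtype.ext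
    apply Subtype.ext
    change diagonal (torusDiag (s * t)) = diagonal (torusDiag s) * diagonal (torusDiag t)
    rw [diagonal_mul_diagonal]
    congr 1
    ext a
    rcases a with (i | i) | i <;> simp [torusDiag, mul_comm]

/-- The maximal torus `T` of `SO_{2n+1}` that consists of the diagonal matrices. -/
def diagTorus (k : Type*) [Field k] (n : ℕ) : Subgroup (SOOdd k n) := (torusHom k n).range

/-- The coordinate ring `k[SO_{2n+1}]`: polynomials in the matrix entries. -/
def coordSO (k : Type*) [Field k] (n : ℕ) : Subalgebra k (SOOdd k n → k) :=
  regularFunctions k (fun (g : SOOdd k n) (p : OddIndex n × OddIndex n) => soMat g p.1 p.2)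

/-- The algebra of functions in `k[SO_{2n+1}]` that are invariant under the action
`(a, b) ∘ g = a g b⁻¹` of `F × H`. -/
def doubleInvariants (k : Type*) [Field k] (n : ℕ) (F H : Subgroup (SOOdd k n)) :
    Subalgebra k (SOOdd k n → k) :=
  invariantFunctions (coordSO k n)
    (fun (s : F × H) (g : SOOdd k n) => (s.1 : SOOdd k n) * g * (s.2 : SOOdd k n)⁻¹)

/-! ### The quadric and its torus quotient -/

/-- The quadric `Z = {x₁x'₁ + ⋯ + xₙx'ₙ + x² = 1}` in `k^{2n+1}`. -/
def quadric (k : Type*) [Field k] (n : ℕ) : Set (OddIndex n → k) :=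
  {v | ∑ i : Fin n, v (.inl (.inl i)) * v (.inl (.inr i)) + v (.inr ()) ^ 2 = 1}

/-- The coordinate ring `k[Z]`. -/
def coordQuadric (k : Type*) [Field k] (n : ℕ) : Subalgebra k (quadric k n → k) :=
  regularFunctions k (fun (v : quadric k n) => (v : OddIndex n → k))

/-- The action of the diagonal torus on the quadric; `t` multiplies `xᵢ` by `tᵢ` and `x'ᵢ` by
`tᵢ⁻¹`, and fixes `x`. -/
def torusActQuadric {k : Type*} [Field k] {n : ℕ} (t : diagTorus k n) (v : quadric k n) :
    quadric k n :=
  ⟨soMat (t : SOOdd k n) *ᵥ (v : OddIndex n → k), by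
    obtain ⟨t, s, rfl⟩ := t
    obtain ⟨v, hv⟩ := v
    change ∑ i : Fin n, (diagonal (torusDiag s) *ᵥ v) (.inl (.inl i)) *
      (diagonal (torusDiag s) *ᵥ v) (.inl (.inr i)) +
      (diagonal (torusDiag s) *ᵥ v) (.inr ()) ^ 2 = 1
    simp only [mulVec_diagonal, torusDiag, Sum.elim_inl, Sum.elim_inr, one_mul]
    rw [← show _ = (1 : k) from hv]
    congr 1
    refine Finset.sum_congr rfl fun i _ => ?_
    have h : (s i : k) * ((s i)⁻¹ : kˣ) = 1 := Units.mul_inv _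
    linear_combination (v (.inl (.inl i)) * v (.inl (.inr i))) * h⟩

/-- The algebra of invariants `k[Z]^T`. -/
def torusInvariantsQuadric (k : Type*) [Field k] (n : ℕ) : Subalgebra k (quadric k n → k) :=
  invariantFunctions (coordQuadric k n) (fun t : diagTorus k n => torusActQuadric t)

/-- The orbit map `SO_{2n+1} → Z`, `g ↦ g e`, in the coordinates `xᵢ = 2 (g e)ᵢ`, `x'ᵢ = (g e)'ᵢ`
and `x`, in which the equation `(v, v) = 2 ∑ vᵢ v'ᵢ + v₀² = 1` of the orbit of `e` reads
`∑ xᵢ x'ᵢ + x² = 1`. -/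
def orbitMap {k : Type*} [Field k] {n : ℕ} (g : SOOdd k n) : quadric k n :=
  ⟨Sum.elim (Sum.elim (fun i => 2 * soMat g (.inl (.inl i)) (.inr ()))
      (fun i => soMat g (.inl (.inr i)) (.inr ()))) (fun _ => soMat g (.inr ()) (.inr ())), by
    have h : (soMat g)ᵀ * oddForm k n * soMat g = oddForm k n := g.2
    have h' := congrFun (congrFun h (.inr ())) (.inr ())
    simp [oddForm, evenForm, Matrix.mul_apply, Fintype.sum_sum_type, Matrix.one_apply] at h'
    change ∑ i : Fin n, 2 * soMat g (.inl (.inl i)) (.inr ()) * soMat g (.inl (.inr i)) (.inr ()) +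
      soMat g (.inr ()) (.inr ()) ^ 2 = 1
    rw [← h', ← Finset.sum_add_distrib]
    refine congrArg₂ (· + ·) (Finset.sum_congr rfl fun i _ => ?_) ?_ <;> ring⟩

/-- The hypersurface `{z₁ + ⋯ + zₙ + x² = 1}` in `k^{n+1}`; `inl i` is the index of the coordinate
`zᵢ` and `inr ()` that of `x`. -/
def parabolicCylinder (k : Type*) [Field k] (n : ℕ) : Set (Fin n ⊕ Unit → k) :=
  {p | ∑ i : Fin n, p (.inl i) + p (.inr ()) ^ 2 = 1}

/-- The coordinate ring of the hypersurface `{z₁ + ⋯ + zₙ + x² = 1}`. -/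
def coordParabolicCylinder (k : Type*) [Field k] (n : ℕ) :
    Subalgebra k (parabolicCylinder k n → k) :=
  regularFunctions k (fun (p : parabolicCylinder k n) => (p : Fin n ⊕ Unit → k))

/-- The map `Z → {z₁ + ⋯ + zₙ + x² = 1}` given by `zᵢ = xᵢ x'ᵢ` and `x = x`. -/
def torusQuotientMap {k : Type*} [Field k] {n : ℕ} (v : quadric k n) : parabolicCylinder k n :=
  ⟨Sum.elim (fun i => (v : OddIndex n → k) (.inl (.inl i)) * (v : OddIndex n → k) (.inl (.inr i)))
      (fun _ => (v : OddIndex n → k) (.inr ())), v.2⟩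

/-- The parabola `{z + x² = 1}` in the plane with coordinates `(z, x)`. -/
def parabola (k : Type*) [Field k] : Set (k × k) := {p | p.1 + p.2 ^ 2 = 1}

/-- The algebra `k[𝔸ⁿ]` of polynomial functions on `kⁿ`. -/
def coordAffineSpace (k : Type*) [Field k] (n : ℕ) : Subalgebra k ((Fin n → k) → k) :=
  regularFunctions k (fun (p : Fin n → k) => p)

end

/-! ### Algebras of functions: membership, pullback and descent -/

section FunctionAlgebras

variable {k : Type*} [Field k] {X Y σ τ : Type*}

/-! The identification of the homogeneous space with `Z` rests on an explicit form of Witt's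
theorem. A point of `Z` encodes a vector `w` with `(w, w) = 1`. For `ε = ±1` the reflection in `w +
εe` sends `e` to `-εw`. Hence `-ε` times this reflection, composed with an isometry of determinant
`ε` that fixes `e`, is an element of `SO_{2n+1}` that sends `e` to `w`. It exists where `1 + εx ≠
0`, and its entries are fractions with denominator `1 + εx` (`exists_local_section`).

The functions `1 + x` and `1 - x` generate the unit ideal, so the two sections together cover `Z`.
This gives surjectivity (`orbitMap_surjective`) and, after clearing denominators, shows that a
function on `Z` is regular as soon as its pullback to the group is
(`mem_coordQuadric_of_comp_orbitMap_mem`). The stabilizer of `e` is `SO_{2n}`, so right invariant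
functions descend to `Z`, and equivariance matches the `T`-invariants.

For `Z//T`, independence of characters reduces an invariant function to its terms of trivial weight
(`eq_sum_filter_of_invariant`). These have equal exponents at `xᵢ` and `x'ᵢ`, so they are monomials
in the `xᵢx'ᵢ` and `x`. Finally, the equation of `Y` can be solved for `z₁`, which makes `Y` the
graph of a polynomial on affine space. -/

theorem coord_mem_regularFunctions (c : X → σ → k) (i : σ) :
    (fun x => c x i) ∈ regularFunctions k c :=
  ⟨MvPolynomial.X i, by simp⟩

theorem const_mem {A : Subalgebra k (X → k)} (r : k) : (fun _ => r) ∈ A :=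
  A.algebraMap_mem r

/-- A regular function is a polynomial in the coordinates, evaluated pointwise. -/
theorem mem_regularFunctions_iff (c : X → σ → k) (f : X → k) :
    f ∈ regularFunctions k c ↔ ∃ P : MvPolynomial σ k, ∀ x, f x = MvPolynomial.eval (c x) P := by
  have key (P : MvPolynomial σ k) (x : X) :
      (MvPolynomial.aeval (fun (i : σ) (x : X) => c x i) P : X → k) x =
        MvPolynomial.eval (c x) P := by
    induction P using MvPolynomial.induction_on with
    | C a => simp
    | add p q hp hq => simp [hp, hq]
    | mul_X p i hp => simp [hp]
  constructor
  · rintro ⟨P, rfl⟩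
    exact ⟨P, fun x => key P x⟩
  · rintro ⟨P, hP⟩
    exact ⟨P, funext fun x => (key P x).trans (hP x).symm⟩

/-- Regular functions pull back to elements of `A` as soon as the coordinates do. -/
theorem comp_mem_of_coord_mem (c : Y → τ → k) {A : Subalgebra k (X → k)} (π : X → Y)
    (h : ∀ j, (fun x => c (π x) j) ∈ A) {f : Y → k} (hf : f ∈ regularFunctions k c) :
    f ∘ π ∈ A := by
  obtain ⟨P, hP⟩ := (mem_regularFunctions_iff c f).1 hf
  induction P using MvPolynomial.induction_on generalizing f with
  | C a =>
    have : f ∘ π = fun _ => a := funext fun x => by simp [hP]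
    rw [this]
    exact const_mem a
  | add p q hp hq =>
    have : f ∘ π = (fun y => MvPolynomial.eval (c y) p) ∘ π +
        (fun y => MvPolynomial.eval (c y) q) ∘ π := funext fun x => by simp [hP]
    rw [this]
    exact A.add_mem (hp ((mem_regularFunctions_iff c _).2 ⟨p, fun _ => rfl⟩) fun _ => rfl)
      (hq ((mem_regularFunctions_iff c _).2 ⟨q, fun _ => rfl⟩) fun _ => rfl)
  | mul_X p j hp =>
    have : f ∘ π = ((fun y => MvPolynomial.eval (c y) p) ∘ π) * fun x => c (π x) j :=
      funext fun x => by simp [hP]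
    rw [this]
    exact A.mul_mem (hp ((mem_regularFunctions_iff c _).2 ⟨p, fun _ => rfl⟩) fun _ => rfl) (h j)

/-- Surjectivity of `π` makes pullback injective, because elements of `B` are genuine functions.
What remains to be checked for each map is that functions pull back into `A` and that those in `A`
descend. -/
theorem pullbackIso_of_surjective {π : X → Y} (hπ : Function.Surjective π)
    {B : Subalgebra k (Y → k)} {A : Subalgebra k (X → k)}
    (hBA : ∀ f ∈ B, f ∘ π ∈ A) (hAB : ∀ f ∈ A, ∃ b ∈ B, ∀ x, f x = b (π x)) :
    PullbackIso π B A := by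
  let φ : B →ₐ[k] A :=
    { toFun := fun f => ⟨(f : Y → k) ∘ π, hBA f f.2⟩
      map_one' := rfl
      map_mul' := fun _ _ => rfl
      map_zero' := rfl
      map_add' := fun _ _ => rfl
      commutes' := fun _ => rfl }
  refine ⟨AlgEquiv.ofBijective φ ⟨fun f g h => ?_, fun f => ?_⟩, fun f x => rfl⟩
  · apply Subtype.ext
    funext y
    obtain ⟨x, rfl⟩ := hπ y
    exact congrFun (congrArg Subtype.val h) x
  · obtain ⟨b, hb, h⟩ := hAB f f.2
    exact ⟨⟨b, hb⟩, Subtype.ext (funext fun x => (h x).symm)⟩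

/-- Clearing denominators: where `h ≠ 0`, a polynomial in fractions with denominator `h` becomes an
element of the algebra after multiplication with a power of `h`. -/
theorem exists_pow_mul_eval_eq (A : Subalgebra k (X → k)) {h : X → k} (hh : h ∈ A)
    (q : σ → X → k) (hq : ∀ i, q i ∈ A) (P : MvPolynomial σ k) :
    ∃ N : ℕ, ∃ a ∈ A, ∀ (x : X) (u : σ → k), (∀ i, u i * h x = q i x) →
      h x ^ N * MvPolynomial.eval u P = a x := by
  induction P using MvPolynomial.induction_on with
  | C r => exact ⟨0, fun _ => r, const_mem r, fun x u _ => by simp⟩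
  | add p q hp hq =>
    obtain ⟨N, a, ha, hp⟩ := hp
    obtain ⟨M, b, hb, hq⟩ := hq
    refine ⟨N + M, h ^ M * a + h ^ N * b, A.add_mem (A.mul_mem (A.pow_mem hh M) ha)
      (A.mul_mem (A.pow_mem hh N) hb), fun x u hu => ?_⟩
    simp only [map_add, Pi.add_apply, Pi.mul_apply, Pi.pow_apply, ← hp x u hu, ← hq x u hu]
    ring
  | mul_X p i hp =>
    obtain ⟨N, a, ha, hp⟩ := hp
    refine ⟨N + 1, a * q i, A.mul_mem ha (hq i), fun x u hu => ?_⟩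
    simp only [map_mul, MvPolynomial.eval_X, Pi.mul_apply, ← hp x u hu, ← hu i]
    ring

/-- A function is in `A` if its products with powers of two functions that generate the unit ideal
of `A` are. -/
theorem mem_of_isCoprime {A : Subalgebra k (X → k)} {h₁ h₂ : A} (hc : IsCoprime h₁ h₂) {f : X → k}
    {N M : ℕ} (hN : (h₁ : X → k) ^ N * f ∈ A) (hM : (h₂ : X → k) ^ M * f ∈ A) : f ∈ A := by
  obtain ⟨a, b, hab⟩ := hc.pow (m := N) (n := M)
  have hab' : (a : X → k) * (h₁ : X → k) ^ N + (b : X → k) * (h₂ : X → k) ^ M = 1 :=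
    congrArg Subtype.val hab
  have : f = (a : X → k) * ((h₁ : X → k) ^ N * f) + (b : X → k) * ((h₂ : X → k) ^ M * f) := by
    rw [← mul_assoc, ← mul_assoc, ← add_mul, hab', one_mul]
  rw [this]
  exact A.add_mem (A.mul_mem a.2 hN) (A.mul_mem b.2 hM)

end FunctionAlgebras

/-! ### Reflections for a symmetric bilinear form -/

section Reflections

variable {k : Type*} [Field k] {ι : Type*} [Fintype ι] [DecidableEq ι]

/-- The reflection in the vector `u` for the form with Gram matrix `J`. -/
noncomputable def gramReflection (J : Matrix ι ι k) (u : ι → k) : Matrix ι ι k :=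
  1 - (2 / (u ⬝ᵥ J *ᵥ u)) • vecMulVec u (J *ᵥ u)

theorem gramReflection_isometry {J : Matrix ι ι k} (hJ : Jᵀ = J) {u : ι → k}
    (hu : u ⬝ᵥ J *ᵥ u ≠ 0) :
    (gramReflection J u)ᵀ * J * gramReflection J u = J := by
  have h1 : u ᵥ* J = J *ᵥ u := by rw [← mulVec_transpose, hJ]
  have h2 : (2 / (u ⬝ᵥ J *ᵥ u)) * (u ⬝ᵥ J *ᵥ u) = 2 := div_mul_cancel₀ _ hu
  simp only [gramReflection, transpose_sub, transpose_one, transpose_smul, transpose_vecMulVec,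
    Matrix.sub_mul, Matrix.mul_sub, Matrix.one_mul, Matrix.mul_one, Matrix.smul_mul,
    Matrix.mul_smul, vecMulVec_mul, mul_vecMulVec, h1]
  rw [sub_mulVec, smul_mulVec, vecMulVec_mulVec]
  ext i j
  have h3 : (J *ᵥ u) ⬝ᵥ u = u ⬝ᵥ J *ᵥ u := dotProduct_comm _ _
  simp [vecMulVec_apply, h3]
  set c := u ⬝ᵥ J *ᵥ u
  linear_combination (2 / c) * (J *ᵥ u) i * (J *ᵥ u) j * h2

theorem det_gramReflection {J : Matrix ι ι k} {u : ι → k} (hu : u ⬝ᵥ J *ᵥ u ≠ 0) :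
    (gramReflection J u).det = -1 := by
  have h2 : (2 / (u ⬝ᵥ J *ᵥ u)) * (u ⬝ᵥ J *ᵥ u) = 2 := div_mul_cancel₀ _ hu
  -- A reflection is a rank one perturbation of the identity, so the matrix determinant lemma gives
  -- `1 - 2 = -1`.
  have : gramReflection J u = 1 + replicateCol Unit u *
      replicateRow Unit (-(2 / (u ⬝ᵥ J *ᵥ u)) • (J *ᵥ u)) := by
    ext i j
    simp [gramReflection, vecMulVec_apply, Matrix.mul_apply]
    ring
  rw [this, det_one_add_replicateCol_mul_replicateRow, smul_dotProduct,
    dotProduct_comm (J *ᵥ u) u, smul_eq_mul, neg_mul, h2]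
  norm_num

theorem gramReflection_mulVec (J : Matrix ι ι k) (u v : ι → k) :
    gramReflection J u *ᵥ v = v - ((2 / (u ⬝ᵥ J *ᵥ u)) * ((J *ᵥ u) ⬝ᵥ v)) • u := by
  rw [gramReflection, sub_mulVec, one_mulVec, smul_mulVec, vecMulVec_mulVec]
  ext i
  simp
  ring

end Reflections

/-! ### The quotient of the quadric by the torus -/

section TorusQuotient

variable {k : Type*} [Field k] {n : ℕ}

theorem coord_mem_coordQuadric (a : OddIndex n) :
    (fun v : quadric k n => (v : OddIndex n → k) a) ∈ coordQuadric k n :=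
  coord_mem_regularFunctions (fun v : quadric k n => (v : OddIndex n → k)) a

theorem coord_mem_coordParabolicCylinder (a : Fin n ⊕ Unit) :
    (fun p : parabolicCylinder k n => (p : Fin n ⊕ Unit → k) a) ∈ coordParabolicCylinder k n :=
  coord_mem_regularFunctions (fun p : parabolicCylinder k n => (p : Fin n ⊕ Unit → k)) a

theorem torusHom_act_apply (s : Fin n → kˣ) (v : quadric k n) (a : OddIndex n) :
    (torusActQuadric ⟨torusHom k n s, s, rfl⟩ v : OddIndex n → k) a =
      torusDiag s a * (v : OddIndex n → k) a :=
  mulVec_diagonal (torusDiag s) (v : OddIndex n → k) a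

theorem torusQuotientMap_torusActQuadric (t : diagTorus k n) (v : quadric k n) :
    torusQuotientMap (torusActQuadric t v) = torusQuotientMap v := by
  obtain ⟨_, s, rfl⟩ := t
  apply Subtype.ext
  funext a
  rcases a with i | i
  · change (torusActQuadric ⟨torusHom k n s, s, rfl⟩ v : OddIndex n → k) _ *
      (torusActQuadric ⟨torusHom k n s, s, rfl⟩ v : OddIndex n → k) _ = _ * _
    rw [torusHom_act_apply, torusHom_act_apply]
    have h : (s i : k) * ((s i)⁻¹ : kˣ) = 1 := Units.mul_inv _
    simp only [torusDiag, Sum.elim_inl, Sum.elim_inr]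
    linear_combination
      ((v : OddIndex n → k) (.inl (.inl i)) * (v : OddIndex n → k) (.inl (.inr i))) * h
  · change (torusActQuadric ⟨torusHom k n s, s, rfl⟩ v : OddIndex n → k) _ =
      (v : OddIndex n → k) _
    rw [torusHom_act_apply]
    simp [torusDiag]

theorem torusQuotientMap_surjective :
    Function.Surjective (torusQuotientMap : quadric k n → parabolicCylinder k n) := by
  rintro ⟨p, hp⟩
  -- Taking every `x'ᵢ = 1` and `xᵢ = zᵢ` gives a section of the quotient map.
  refine ⟨⟨Sum.elim (Sum.elim (fun i => p (.inl i)) fun _ => 1) fun _ => p (.inr ()), ?_⟩, ?_⟩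
  · simpa [quadric, parabolicCylinder] using hp
  · apply Subtype.ext
    funext a
    rcases a with i | i <;> simp [torusQuotientMap]

/-- The character by which the torus acts on the monomial with exponent vector `d`. -/
def monomialCharacter (k : Type*) [Field k] {n : ℕ} (d : OddIndex n →₀ ℕ) :
    (Fin n → kˣ) →* k where
  toFun s := ∏ a, torusDiag s a ^ d a
  map_one' := by simp [torusDiag]
  map_mul' s t := by
    rw [← Finset.prod_mul_distrib]
    refine Finset.prod_congr rfl fun a _ => ?_
    rw [← mul_pow]
    congr 1
    rcases a with (i | i) | i <;> simp [torusDiag, mul_comm]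

/-- Evaluating the character at the torus point with `i`-th entry `2` and all others `1` gives `2 ^
a = 2 ^ b` for the two exponents, and `2` has infinite multiplicative order in characteristic zero.
-/
theorem exponents_eq_of_monomialCharacter_eq_one [CharZero k] {d : OddIndex n →₀ ℕ}
    (h : monomialCharacter k d = 1) (i : Fin n) : d (.inl (.inl i)) = d (.inl (.inr i)) := by
  have h2 : (2 : k) ≠ 0 := two_ne_zero
  have hs := DFunLike.congr_fun h (Pi.mulSingle i (Units.mk0 2 h2))
  change ∏ a, torusDiag (Pi.mulSingle i (Units.mk0 2 h2)) a ^ d a = 1 at hs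
  simp only [Fintype.prod_sum_type, torusDiag, Sum.elim_inl, Sum.elim_inr, one_pow,
    Finset.prod_const_one, mul_one] at hs
  rw [Finset.prod_eq_single i (fun j _ hj => by simp [hj]) (by simp),
    Finset.prod_eq_single i (fun j _ hj => by simp [hj]) (by simp)] at hs
  simp only [Pi.mulSingle_eq_same, Units.val_inv_eq_inv_val, Units.val_mk0, inv_pow] at hs
  rw [mul_inv_eq_one₀ (pow_ne_zero _ h2)] at hs
  exact Nat.pow_right_injective le_rfl (by exact_mod_cast hs)

open Classical in
/-- A torus invariant regular function on the quadric is the sum of the terms of trivial weight. -/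
theorem eq_sum_filter_of_invariant {f : quadric k n → k} {P : MvPolynomial (OddIndex n) k}
    (hP : ∀ v : quadric k n, f v = MvPolynomial.eval (v : OddIndex n → k) P)
    (hf : ∀ (t : diagTorus k n) v, f (torusActQuadric t v) = f v) (v : quadric k n) :
    f v = ∑ d ∈ P.support with monomialCharacter k d = 1,
      P.coeff d * ∏ a, (v : OddIndex n → k) a ^ d a := by
  -- The point `v` is fixed and `s` varies: invariance is then a linear relation between characters
  -- of the torus, whose coefficients are values at `v`. Independence of characters kills each
  -- coefficient, and the one at the trivial character is the claim. Working pointwise avoids the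
  -- ambiguity of `P` modulo the equation of the quadric.
  have hli := linearIndependent_iff.1 (linearIndependent_monoidHom (Fin n → kˣ) k)
    ((∑ d ∈ P.support, Finsupp.single (monomialCharacter k d)
      (P.coeff d * ∏ a, (v : OddIndex n → k) a ^ d a)) - Finsupp.single 1 (f v)) ?_
  · have := DFunLike.congr_fun hli 1
    rw [Finsupp.sub_apply, Finsupp.finsetSum_apply, Finsupp.single_eq_same, Finsupp.zero_apply,
      sub_eq_zero] at this
    rw [← this, Finset.sum_filter]
    exact Finset.sum_congr rfl fun d _ => Finsupp.single_apply
  · funext s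
    have hs := hf ⟨torusHom k n s, s, rfl⟩ v
    rw [hP, MvPolynomial.eval_eq'] at hs
    simp only [map_sub, map_sum, Finsupp.linearCombination_single, Pi.sub_apply,
      Finset.sum_apply, Pi.smul_apply, MonoidHom.one_apply, smul_eq_mul, mul_one, Pi.zero_apply]
    rw [← hs, sub_eq_zero]
    refine Finset.sum_congr rfl fun d _ => ?_
    simp only [torusHom_act_apply, mul_pow, Finset.prod_mul_distrib]
    change _ * ∏ a, torusDiag s a ^ d a = _
    ring

theorem pullbackIso_torusQuotientMap [CharZero k] :
    PullbackIso (torusQuotientMap : quadric k n → parabolicCylinder k n)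
      (coordParabolicCylinder k n) (torusInvariantsQuadric k n) := by
  classical
  refine pullbackIso_of_surjective torusQuotientMap_surjective (fun f hf => ⟨?_, ?_⟩) ?_
  · refine comp_mem_of_coord_mem _ torusQuotientMap (fun j => ?_) hf
    rcases j with i | i
    · exact (coordQuadric k n).mul_mem (coord_mem_coordQuadric (.inl (.inl i)))
        (coord_mem_coordQuadric (.inl (.inr i)))
    · exact coord_mem_coordQuadric (.inr ())
  · intro t v
    rw [Function.comp_apply, Function.comp_apply, torusQuotientMap_torusActQuadric]
  · rintro f ⟨hf, hinv⟩
    obtain ⟨P, hP⟩ := (mem_regularFunctions_iff _ f).1 hf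
    -- In a term of trivial weight `xᵢ` and `x'ᵢ` have the same exponent, so the exponent of `xᵢ`
    -- alone serves as that of `zᵢ`.
    refine ⟨∑ d ∈ P.support with monomialCharacter k d = 1, (fun _ => P.coeff d) *
      ((∏ i, (fun p : parabolicCylinder k n => (p : Fin n ⊕ Unit → k) (.inl i)) ^
        d (.inl (.inl i))) *
      (fun p : parabolicCylinder k n => (p : Fin n ⊕ Unit → k) (.inr ())) ^ d (.inr ())), ?_, ?_⟩
    · refine Subalgebra.sum_mem _ fun d _ => Subalgebra.mul_mem _ (const_mem _)
        (Subalgebra.mul_mem _ (Subalgebra.prod_mem _ fun i _ => Subalgebra.pow_mem _ ?_ _)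
          (Subalgebra.pow_mem _ ?_ _)) <;> exact coord_mem_coordParabolicCylinder _
    · intro v
      rw [eq_sum_filter_of_invariant hP hinv v, Finset.sum_apply]
      refine Finset.sum_congr rfl fun d hd => ?_
      have h := exponents_eq_of_monomialCharacter_eq_one (Finset.mem_filter.1 hd).2
      simp [Fintype.prod_sum_type, torusQuotientMap, mul_pow, Finset.prod_mul_distrib, h]

end TorusQuotient

/-! ### The hypersurface as a cylinder over a parabola and as an affine space -/

section Cylinder

variable {k : Type*} [Field k]

/-- The linear change of coordinates that makes the sum of the `zᵢ` a coordinate. -/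
def sumCoordinate (k : Type*) [Field k] (m : ℕ) :
    (Fin (m + 1) ⊕ Unit → k) ≃ₗ[k] (k × k) × (Fin m → k) where
  toFun p := ((∑ i, p (.inl i), p (.inr ())), fun i => p (.inl i.succ))
  map_add' p q := by
    ext <;> simp [Finset.sum_add_distrib]
  map_smul' c p := by
    ext <;> simp [Finset.mul_sum]
  invFun q := Sum.elim (Fin.cons (q.1.1 - ∑ i, q.2 i) q.2) fun _ => q.1.2
  left_inv p := by
    funext a
    rcases a with i | i
    · refine Fin.cases ?_ (fun j => ?_) i <;> simp [Fin.sum_univ_succ]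
    · rfl
  right_inv q := by
    ext <;> simp [Fin.sum_univ_succ]

theorem sumCoordinate_image (m : ℕ) :
    sumCoordinate k m '' parabolicCylinder k (m + 1) = parabola k ×ˢ Set.univ := by
  ext q
  rw [Set.mem_prod, ← LinearEquiv.coe_toEquiv, Equiv.image_eq_preimage_symm, Set.mem_preimage]
  obtain ⟨p, rfl⟩ := (sumCoordinate k m).surjective q
  simp [parabola, parabolicCylinder, sumCoordinate, Fin.sum_univ_succ]

/-- The hypersurface as a graph over affine space, with coordinates `x, z₂, …, zₙ`. -/
def graphEquiv (k : Type*) [Field k] (m : ℕ) :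
    (Fin (m + 1) → k) ≃ parabolicCylinder k (m + 1) where
  toFun p := ⟨Sum.elim (Fin.cons (1 - p 0 ^ 2 - ∑ i : Fin m, p i.succ) fun i => p i.succ)
    fun _ => p 0, by simp [parabolicCylinder, Fin.sum_univ_succ]⟩
  invFun q := Fin.cons ((q : Fin (m + 1) ⊕ Unit → k) (.inr ()))
    fun i => (q : Fin (m + 1) ⊕ Unit → k) (.inl i.succ)
  left_inv p := by
    funext i
    refine Fin.cases ?_ (fun j => ?_) i <;> simp
  right_inv q := by
    obtain ⟨q, hq⟩ := q
    apply Subtype.ext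
    funext a
    have hq' : ∑ i : Fin (m + 1), q (.inl i) + q (.inr ()) ^ 2 = 1 := hq
    rw [Fin.sum_univ_succ] at hq'
    rcases a with i | i
    · refine Fin.cases ?_ (fun j => ?_) i
      · simp
        linear_combination -hq'
      · simp
    · rfl

/-- Both directions of `graphEquiv` are polynomial: one inserts `z₁ = 1 - x² - z₂ - ⋯`, the other
forgets `z₁`. -/
theorem pullbackIso_graphEquiv (m : ℕ) :
    PullbackIso (graphEquiv k m) (coordParabolicCylinder k (m + 1))
      (coordAffineSpace k (m + 1)) := by
  refine pullbackIso_of_surjective (graphEquiv k m).surjective (fun f hf => ?_) fun f hf => ?_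
  · refine comp_mem_of_coord_mem _ _ (fun j => ?_) hf
    rcases j with i | i
    · refine Fin.cases ?_ (fun j => coord_mem_regularFunctions _ j.succ) i
      have : (fun x : Fin (m + 1) → k => 1 - x 0 ^ 2 - ∑ i : Fin m, x i.succ) =
          (1 - (fun x => x 0) ^ 2 - ∑ i : Fin m, fun x => x i.succ) := by
        funext x
        simp
      change (fun x : Fin (m + 1) → k => 1 - x 0 ^ 2 - ∑ i : Fin m, x i.succ) ∈ _
      rw [this]
      exact Subalgebra.sub_mem _ (Subalgebra.sub_mem _ (Subalgebra.one_mem _)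
        (Subalgebra.pow_mem _ (coord_mem_regularFunctions _ 0) 2))
        (Subalgebra.sum_mem _ fun i _ => coord_mem_regularFunctions _ i.succ)
    · exact coord_mem_regularFunctions _ 0
  · refine ⟨f ∘ (graphEquiv k m).symm, comp_mem_of_coord_mem _ _ (fun j => ?_) hf,
      fun x => by simp⟩
    refine Fin.cases ?_ (fun i => ?_) j
    · exact coord_mem_coordParabolicCylinder (.inr ())
    · exact coord_mem_coordParabolicCylinder (.inl i.succ)

/-- Over an infinite field a polynomial is determined by its values. -/
theorem nonempty_mvPolynomial_algEquiv_coordAffineSpace [Infinite k] (n : ℕ) :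
    Nonempty (MvPolynomial (Fin n) k ≃ₐ[k] coordAffineSpace k n) := by
  refine ⟨AlgEquiv.ofInjective (MvPolynomial.aeval fun (i : Fin n) (x : Fin n → k) => x i)
    fun p q h => MvPolynomial.funext fun x => ?_⟩
  have key (P : MvPolynomial (Fin n) k) :
      (MvPolynomial.aeval (fun (i : Fin n) (x : Fin n → k) => x i) P : (Fin n → k) → k) x =
        MvPolynomial.eval x P := by
    induction P using MvPolynomial.induction_on with
    | C a => simp
    | add p q hp hq => simp [hp, hq]
    | mul_X p i hp => simp [hp]
  rw [← key, ← key, h]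

end Cylinder

/-! ### The orbit map, its local sections and descent of regular functions -/

section OrbitMap

variable {k : Type*} [Field k] {n : ℕ}

theorem oddForm_transpose : (oddForm k n)ᵀ = oddForm k n := by
  simp [oddForm, evenForm, fromBlocks_transpose]

theorem oddForm_mulVec_inl_inl (u : OddIndex n → k) (i : Fin n) :
    (oddForm k n *ᵥ u) (.inl (.inl i)) = u (.inl (.inr i)) := by
  simp [oddForm, evenForm, mulVec, dotProduct, Fintype.sum_sum_type, Matrix.one_apply]

theorem oddForm_mulVec_inl_inr (u : OddIndex n → k) (i : Fin n) :
    (oddForm k n *ᵥ u) (.inl (.inr i)) = u (.inl (.inl i)) := by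
  simp [oddForm, evenForm, mulVec, dotProduct, Fintype.sum_sum_type, Matrix.one_apply]

theorem oddForm_mulVec_inr (u : OddIndex n → k) :
    (oddForm k n *ᵥ u) (.inr ()) = u (.inr ()) := by
  simp [oddForm, mulVec, dotProduct, Fintype.sum_sum_type]

theorem dotProduct_oddForm_mulVec (u : OddIndex n → k) :
    u ⬝ᵥ oddForm k n *ᵥ u =
      2 * ∑ i : Fin n, u (.inl (.inl i)) * u (.inl (.inr i)) + u (.inr ()) ^ 2 := by
  simp only [dotProduct, Fintype.sum_sum_type, oddForm_mulVec_inl_inl, oddForm_mulVec_inl_inr,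
    Finset.univ_unique, Finset.sum_singleton, PUnit.default_eq_unit, oddForm_mulVec_inr]
  rw [Finset.sum_congr rfl fun i _ => mul_comm (u (.inl (.inr i))) (u (.inl (.inl i)))]
  ring

theorem orbitMap_torus_mul (t : diagTorus k n) (g : SOOdd k n) :
    orbitMap ((t : SOOdd k n) * g) = torusActQuadric t (orbitMap g) := by
  obtain ⟨_, s, rfl⟩ := t
  apply Subtype.ext
  funext a
  rw [torusHom_act_apply]
  have h (a b : OddIndex n) : soMat (torusHom k n s * g) a b = torusDiag s a * soMat g a b :=
    diagonal_mul _ _ _ _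
  rcases a with (i | i) | i <;> simp only [orbitMap, h, Sum.elim_inl, Sum.elim_inr]
  ring

theorem orbitMap_eq_iff [CharZero k] (g g' : SOOdd k n) :
    orbitMap g = orbitMap g' ↔ ∀ a, soMat g a (.inr ()) = soMat g' a (.inr ()) := by
  constructor
  · intro h a
    rcases a with (i | i) | i
    · have := congrFun (congrArg Subtype.val h) (.inl (.inl i))
      exact mul_left_cancel₀ two_ne_zero this
    · exact congrFun (congrArg Subtype.val h) (.inl (.inr i))
    · exact congrFun (congrArg Subtype.val h) (.inr ())
  · intro h
    apply Subtype.ext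
    funext a
    rcases a with (i | i) | i <;> simp only [orbitMap, h, Sum.elim_inl, Sum.elim_inr]

/-- The subgroup `SO_{2n}` is the stabilizer of the last basis vector. -/
theorem mem_soSubgroup_iff (h : SOOdd k n) :
    h ∈ soSubgroup k n ↔ ∀ a, soMat h a (.inr ()) = (1 : Matrix (OddIndex n) (OddIndex n) k) a (.inr ()) := by
  constructor
  · rintro ⟨A, rfl⟩ a
    change fromBlocks (A : SpecialLinearGroup (EvenIndex n) k).1 0 0 1 a (.inr ()) = _
    rcases a with a | a <;> simp
  · intro hcol
    have hb : (soMat h).toBlocks₁₂ = 0 := by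
      ext a b
      exact (hcol (.inl a)).trans (by simp)
    have hd : (soMat h).toBlocks₂₂ = 1 := by
      ext a b
      exact (hcol (.inr a)).trans (by simp)
    have hM : soMat h = fromBlocks (soMat h).toBlocks₁₁ 0 (soMat h).toBlocks₂₁ 1 := by
      conv_lhs => rw [← fromBlocks_toBlocks (soMat h), hb, hd]
    have hiso : (soMat h)ᵀ * oddForm k n * soMat h = oddForm k n := h.2
    rw [hM, oddForm, fromBlocks_transpose, fromBlocks_multiply, fromBlocks_multiply,
      fromBlocks_inj] at hiso
    simp only [Matrix.mul_zero, Matrix.zero_mul, add_zero, zero_add, transpose_zero, transpose_one,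
      Matrix.mul_one, Matrix.one_mul] at hiso
    -- Preserving the form and fixing `e` means preserving the orthogonal complement of `e`: the
    -- equation `h21` says that the lower left block vanishes.
    obtain ⟨h11, -, h21, -⟩ := hiso
    rw [h21, Matrix.mul_zero, add_zero] at h11
    rw [h21] at hM
    have hdet : (soMat h).toBlocks₁₁.det = 1 := by
      have := (h : SpecialLinearGroup (OddIndex n) k).2
      change (soMat h).det = 1 at this
      rwa [hM, det_fromBlocks_zero₁₂, det_one, mul_one] at this
    exact ⟨⟨⟨(soMat h).toBlocks₁₁, hdet⟩, h11⟩, Subtype.ext (Subtype.ext hM.symm)⟩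

theorem orbitMap_eq_iff_mem_soSubgroup [CharZero k] (g g' : SOOdd k n) :
    orbitMap g = orbitMap g' ↔ g⁻¹ * g' ∈ soSubgroup k n := by
  have hcol (A : SOOdd k n) (B : SOOdd k n) :
      (fun a => soMat (A * B) a (.inr ())) = soMat A *ᵥ fun a => soMat B a (.inr ()) := rfl
  have hone : (fun a => soMat (1 : SOOdd k n) a (.inr ())) =
      fun a => (1 : Matrix (OddIndex n) (OddIndex n) k) a (.inr ()) := rfl
  rw [orbitMap_eq_iff, mem_soSubgroup_iff, ← funext_iff, ← funext_iff, ← hone]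
  constructor
  · intro h
    rw [hcol, ← h, ← hcol, inv_mul_cancel]
  · intro h
    have h' := congrArg (soMat g *ᵥ ·) h
    simp only [← hcol, mul_one, mul_inv_cancel_left] at h'
    exact h'.symm

/-- The vector of the orbit of `e` that is represented by a point of the quadric. -/
noncomputable def orbitVector (v : quadric k n) : OddIndex n → k :=
  Sum.elim (Sum.elim (fun i => (v : OddIndex n → k) (.inl (.inl i)) / 2)
    fun i => (v : OddIndex n → k) (.inl (.inr i))) fun _ => (v : OddIndex n → k) (.inr ())

theorem orbitMap_eq_of_col_eq [CharZero k] {g : SOOdd k n} {v : quadric k n}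
    (h : ∀ a, soMat g a (.inr ()) = orbitVector v a) : orbitMap g = v := by
  apply Subtype.ext
  funext a
  rcases a with (i | i) | i <;> simp only [orbitMap, h, orbitVector, Sum.elim_inl, Sum.elim_inr]
  exact mul_div_cancel₀ _ two_ne_zero

/-- The vector `w + ε e`, where `w` is the vector of the orbit of `e`. -/
noncomputable def mirrorVector (ε : k) (v : quadric k n) : OddIndex n → k :=
  orbitVector v + ε • Pi.single (.inr ()) 1

/-- This is `(w, w) + 2ε(w, e) + ε²(e, e)` with `(w, w) = (e, e) = 1` and `(w, e) = x`. -/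
theorem mirrorVector_sq [CharZero k] {ε : k} (hε : ε * ε = 1) (v : quadric k n) :
    mirrorVector ε v ⬝ᵥ oddForm k n *ᵥ mirrorVector ε v =
      2 * (1 + ε * (v : OddIndex n → k) (.inr ())) := by
  have hv : ∑ i : Fin n, (v : OddIndex n → k) (.inl (.inl i)) * (v : OddIndex n → k) (.inl (.inr i))
    + (v : OddIndex n → k) (.inr ()) ^ 2 = 1 := v.2
  rw [dotProduct_oddForm_mulVec, Finset.mul_sum]
  have (i : Fin n) : 2 * (mirrorVector ε v (.inl (.inl i)) * mirrorVector ε v (.inl (.inr i))) =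
      (v : OddIndex n → k) (.inl (.inl i)) * (v : OddIndex n → k) (.inl (.inr i)) := by
    simp [mirrorVector, orbitVector]
    ring
  rw [Finset.sum_congr rfl fun i _ => this i]
  simp [mirrorVector, orbitVector]
  linear_combination hv + hε

theorem mirrorVector_mem_coordQuadric (ε : k) (a : OddIndex n) :
    (fun v : quadric k n => mirrorVector ε v a) ∈ coordQuadric k n := by
  have h1 : (fun v : quadric k n => orbitVector v a) ∈ coordQuadric k n := by
    rcases a with (i | i) | i
    · have := (coordQuadric k n).mul_mem (coord_mem_coordQuadric (.inl (.inl i)))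
        (const_mem (2 : k)⁻¹)
      simp only [orbitVector, Sum.elim_inl, div_eq_mul_inv]
      exact this
    · exact coord_mem_coordQuadric (.inl (.inr i))
    · exact coord_mem_coordQuadric (.inr ())
  exact (coordQuadric k n).add_mem h1 (const_mem _)

theorem oddForm_mulVec_mirrorVector_mem (ε : k) (a : OddIndex n) :
    (fun v : quadric k n => (oddForm k n *ᵥ mirrorVector ε v) a) ∈ coordQuadric k n := by
  rcases a with (i | i) | ⟨⟩
  · simp only [oddForm_mulVec_inl_inl, mirrorVector_mem_coordQuadric]
  · simp only [oddForm_mulVec_inl_inr, mirrorVector_mem_coordQuadric]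
  · rw [show (fun v : quadric k n => (oddForm k n *ᵥ mirrorVector ε v) (.inr ())) =
      fun v => mirrorVector ε v (.inr ()) from funext fun v => oddForm_mulVec_inr _]
    exact mirrorVector_mem_coordQuadric ε _

/-- The numerator of the reflection in `w + ε e`, whose denominator is `1 + ε x`. -/
noncomputable def reflectionNumerator (ε : k) (v : quadric k n) :
    Matrix (OddIndex n) (OddIndex n) k :=
  (1 + ε * (v : OddIndex n → k) (.inr ())) • (1 : Matrix _ _ k) -
    vecMulVec (mirrorVector ε v) (oddForm k n *ᵥ mirrorVector ε v)

theorem one_add_mem_coordQuadric (ε : k) :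
    (fun v : quadric k n => 1 + ε * (v : OddIndex n → k) (.inr ())) ∈ coordQuadric k n :=
  (coordQuadric k n).add_mem (const_mem 1)
    ((coordQuadric k n).mul_mem (const_mem ε) (coord_mem_coordQuadric (.inr ())))

theorem reflectionNumerator_mem (ε : k) (a b : OddIndex n) :
    (fun v : quadric k n => reflectionNumerator ε v a b) ∈ coordQuadric k n :=
  (coordQuadric k n).sub_mem
    ((coordQuadric k n).mul_mem (one_add_mem_coordQuadric ε) (const_mem _))
    ((coordQuadric k n).mul_mem (mirrorVector_mem_coordQuadric ε a)
      (oddForm_mulVec_mirrorVector_mem ε b))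

/-- Over the open set `1 + ε x ≠ 0` of the quadric, the orbit map has a section whose matrix
entries are fractions with denominator `1 + ε x`. -/
theorem exists_local_section [CharZero k] {ε : k} (hε : ε * ε = 1)
    {K : Matrix (OddIndex n) (OddIndex n) k} (hK : Kᵀ * oddForm k n * K = oddForm k n)
    (hdet : K.det = ε) (hKe : K *ᵥ Pi.single (.inr ()) 1 = Pi.single (.inr ()) 1) :
    ∃ q : OddIndex n × OddIndex n → quadric k n → k, (∀ p, q p ∈ coordQuadric k n) ∧
      ∀ v : quadric k n, 1 + ε * (v : OddIndex n → k) (.inr ()) ≠ 0 →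
        ∃ g : SOOdd k n, orbitMap g = v ∧ ∀ p : OddIndex n × OddIndex n,
          soMat g p.1 p.2 * (1 + ε * (v : OddIndex n → k) (.inr ())) = q p v := by
  refine ⟨fun p v => -ε * ∑ c, reflectionNumerator ε v p.1 c * K c p.2, fun p => ?_,
    fun v hv => ?_⟩
  · have : (fun v : quadric k n => -ε * ∑ c, reflectionNumerator ε v p.1 c * K c p.2) =
        (fun _ => -ε) * ∑ c, (fun v => reflectionNumerator ε v p.1 c) * fun _ => K c p.2 := by
      funext v
      simp
    change (fun v : quadric k n => -ε * ∑ c, reflectionNumerator ε v p.1 c * K c p.2) ∈ _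
    rw [this]
    exact (coordQuadric k n).mul_mem (const_mem _) (Subalgebra.sum_mem _ fun c _ =>
      (coordQuadric k n).mul_mem (reflectionNumerator_mem ε p.1 c) (const_mem _))
  · set u := mirrorVector ε v with hu_def
    set d := 1 + ε * (v : OddIndex n → k) (.inr ()) with hd_def
    have hsq : u ⬝ᵥ oddForm k n *ᵥ u = 2 * d := mirrorVector_sq hε v
    have hu : u ⬝ᵥ oddForm k n *ᵥ u ≠ 0 := by
      rw [hsq]
      exact mul_ne_zero two_ne_zero hv
    have hR : d • gramReflection (oddForm k n) u = reflectionNumerator ε v := by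
      rw [gramReflection, hsq, smul_sub, smul_smul, reflectionNumerator, ← hd_def, ← hu_def]
      congr 1
      rw [show d * (2 / (2 * d)) = 1 by field_simp, one_smul]
    -- The scalar `-ε` corrects the image `-εw` of `e` to `w`. In odd dimension it contributes `-ε`
    -- to the determinant, which cancels the `-ε` coming from the reflection and `K`.
    set M := -ε • (gramReflection (oddForm k n) u * K) with hM
    have hiso : Mᵀ * oddForm k n * M = oddForm k n := by
      have h1 := gramReflection_isometry oddForm_transpose hu
      rw [hM, transpose_smul, transpose_mul]
      simp only [Matrix.smul_mul, Matrix.mul_smul, smul_smul, neg_mul_neg, hε, one_smul]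
      calc _ = Kᵀ * ((gramReflection (oddForm k n) u)ᵀ * oddForm k n *
            gramReflection (oddForm k n) u) * K := by simp only [Matrix.mul_assoc]
        _ = _ := by rw [h1, hK]
    have hMdet : M.det = 1 := by
      rw [hM, det_smul, det_mul, det_gramReflection hu, hdet]
      have : Fintype.card (OddIndex n) = 2 * n + 1 := by simp; ring
      rw [this, pow_succ, pow_mul, neg_sq, sq, hε, one_pow]
      linear_combination hε
    refine ⟨⟨⟨M, hMdet⟩, hiso⟩, orbitMap_eq_of_col_eq fun a => ?_, fun p => ?_⟩
    · change M a (.inr ()) = _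
      have hcol : M *ᵥ Pi.single (.inr ()) 1 = orbitVector v := by
        rw [hM, smul_mulVec, ← mulVec_mulVec, hKe, gramReflection_mulVec, dotProduct_single,
          oddForm_mulVec_inr, hsq]
        -- The pairing `(u, e) = x + ε` equals `ε(1 + εx)` because `ε² = 1`. The denominator
        -- therefore cancels, and the reflection sends `e` to `e - εu = -εw`.
        have hue : u (.inr ()) = ε * d := by
          simp [hu_def, hd_def, mirrorVector, orbitVector]
          linear_combination -(v : OddIndex n → k) (.inr ()) * hε
        rw [hue, show 2 / (2 * d) * (ε * d * 1) = ε by field_simp, smul_sub, smul_smul,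
          neg_mul, hε, hu_def, mirrorVector]
        module
      rw [← hcol, mulVec_single_one]
      rfl
    · change M p.1 p.2 * d = -ε * ∑ c, reflectionNumerator ε v p.1 c * K c p.2
      rw [← hR, hM]
      simp only [Matrix.smul_apply, Matrix.mul_apply, smul_eq_mul, mul_assoc, ← Finset.mul_sum]
      ring

/-- The reflection in `e₁ + e'₁` works: this vector has square `2` and is orthogonal to `e`. It
supplies the determinant correction for `ε = -1`, and needs a hyperbolic plane, hence `n > 0`. -/
theorem exists_isometry_det_neg_one [CharZero k] (hn : 0 < n) :
    ∃ K : Matrix (OddIndex n) (OddIndex n) k, Kᵀ * oddForm k n * K = oddForm k n ∧ K.det = -1 ∧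
      K *ᵥ Pi.single (.inr ()) 1 = Pi.single (.inr ()) 1 := by
  let i₀ : Fin n := ⟨0, hn⟩
  let u : OddIndex n → k := Sum.elim (Sum.elim (Pi.single i₀ 1) (Pi.single i₀ 1)) 0
  have hu : u ⬝ᵥ oddForm k n *ᵥ u ≠ 0 := by
    rw [dotProduct_oddForm_mulVec]
    simp [u, Pi.single_apply]
  refine ⟨gramReflection (oddForm k n) u, gramReflection_isometry oddForm_transpose hu,
    det_gramReflection hu, ?_⟩
  rw [gramReflection_mulVec, dotProduct_single, oddForm_mulVec_inr]
  simp [u]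

theorem exists_local_section_pos [CharZero k] :
    ∃ q : OddIndex n × OddIndex n → quadric k n → k, (∀ p, q p ∈ coordQuadric k n) ∧
      ∀ v : quadric k n, 1 + 1 * (v : OddIndex n → k) (.inr ()) ≠ 0 →
        ∃ g : SOOdd k n, orbitMap g = v ∧ ∀ p : OddIndex n × OddIndex n,
          soMat g p.1 p.2 * (1 + 1 * (v : OddIndex n → k) (.inr ())) = q p v :=
  exists_local_section (K := 1) (one_mul 1) (by simp) (by simp) (one_mulVec _)

theorem exists_local_section_neg [CharZero k] (hn : 0 < n) :
    ∃ q : OddIndex n × OddIndex n → quadric k n → k, (∀ p, q p ∈ coordQuadric k n) ∧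
      ∀ v : quadric k n, 1 + -1 * (v : OddIndex n → k) (.inr ()) ≠ 0 →
        ∃ g : SOOdd k n, orbitMap g = v ∧ ∀ p : OddIndex n × OddIndex n,
          soMat g p.1 p.2 * (1 + -1 * (v : OddIndex n → k) (.inr ())) = q p v := by
  obtain ⟨K, hK, hdet, hKe⟩ := exists_isometry_det_neg_one (k := k) hn
  exact exists_local_section (by ring) hK hdet hKe

/-- At each point one of the two local sections is defined, since `1 + x` and `1 - x` have sum `2 ≠
0`. -/
theorem orbitMap_surjective [CharZero k] (hn : 0 < n) :
    Function.Surjective (orbitMap : SOOdd k n → quadric k n) := by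
  intro v
  by_cases h : 1 + 1 * (v : OddIndex n → k) (.inr ()) = 0
  · obtain ⟨q, -, hq⟩ := exists_local_section_neg (k := k) hn
    obtain ⟨g, hg, -⟩ := hq v fun h' => two_ne_zero (α := k) (by linear_combination h + h')
    exact ⟨g, hg⟩
  · obtain ⟨q, -, hq⟩ := exists_local_section_pos (k := k) (n := n)
    obtain ⟨g, hg, -⟩ := hq v h
    exact ⟨g, hg⟩

/-- A function on the quadric whose pullback along the orbit map is regular becomes regular after
multiplication with a power of the denominator of a local section. -/
theorem exists_pow_mul_mem_of_local_section {ε : k}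
    (hs : ∃ q : OddIndex n × OddIndex n → quadric k n → k, (∀ p, q p ∈ coordQuadric k n) ∧
      ∀ v : quadric k n, 1 + ε * (v : OddIndex n → k) (.inr ()) ≠ 0 →
        ∃ g : SOOdd k n, orbitMap g = v ∧ ∀ p : OddIndex n × OddIndex n,
          soMat g p.1 p.2 * (1 + ε * (v : OddIndex n → k) (.inr ())) = q p v)
    {f : quadric k n → k} (hf : f ∘ orbitMap ∈ coordSO k n) :
    ∃ N : ℕ, (fun v : quadric k n => 1 + ε * (v : OddIndex n → k) (.inr ())) ^ N * f ∈
      coordQuadric k n := by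
  obtain ⟨q, hq, hsec⟩ := hs
  obtain ⟨P, hP⟩ := (mem_regularFunctions_iff _ _).1 hf
  obtain ⟨N, a, ha, hN⟩ := exists_pow_mul_eval_eq _ (one_add_mem_coordQuadric ε) q hq P
  -- The relation `hN` is available only where the section exists. The extra factor makes both sides
  -- vanish where the denominator does, so the identity holds on all of the quadric.
  refine ⟨N + 1, ?_⟩
  have : (fun v : quadric k n => 1 + ε * (v : OddIndex n → k) (.inr ())) ^ (N + 1) * f =
      (fun v : quadric k n => 1 + ε * (v : OddIndex n → k) (.inr ())) * a := by
    funext v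
    by_cases hv : 1 + ε * (v : OddIndex n → k) (.inr ()) = 0
    · simp [hv]
    · obtain ⟨g, rfl, hg⟩ := hsec v hv
      have := hN _ _ hg
      rw [← hP, Function.comp_apply] at this
      simp only [Pi.mul_apply, Pi.pow_apply, ← this]
      ring
  rw [this]
  exact (coordQuadric k n).mul_mem (one_add_mem_coordQuadric ε) ha

/-- The two local sections make `f` regular up to powers of `1 + x` and of `1 - x`. These functions
are coprime, as half their sum is `1`, so the denominators can be removed. -/
theorem mem_coordQuadric_of_comp_orbitMap_mem [CharZero k] (hn : 0 < n) {f : quadric k n → k}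
    (hf : f ∘ orbitMap ∈ coordSO k n) : f ∈ coordQuadric k n := by
  obtain ⟨N, hN⟩ := exists_pow_mul_mem_of_local_section exists_local_section_pos hf
  obtain ⟨M, hM⟩ := exists_pow_mul_mem_of_local_section (exists_local_section_neg hn) hf
  refine mem_of_isCoprime (h₁ := ⟨_, one_add_mem_coordQuadric 1⟩)
    (h₂ := ⟨_, one_add_mem_coordQuadric (-1)⟩) ⟨algebraMap k _ 2⁻¹, algebraMap k _ 2⁻¹, ?_⟩ hN hM
  apply Subtype.ext
  funext v
  change (2⁻¹ : k) * (1 + 1 * _) + 2⁻¹ * (1 + -1 * _) = 1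
  ring

theorem comp_orbitMap_mem_coordSO {f : quadric k n → k} (hf : f ∈ coordQuadric k n) :
    f ∘ orbitMap ∈ coordSO k n := by
  have h (a : OddIndex n) : (fun g : SOOdd k n => soMat g a (.inr ())) ∈ coordSO k n :=
    coord_mem_regularFunctions
      (fun (g : SOOdd k n) (p : OddIndex n × OddIndex n) => soMat g p.1 p.2) (a, .inr ())
  refine comp_mem_of_coord_mem _ orbitMap (fun a => ?_) hf
  rcases a with (i | i) | i
  · exact (coordSO k n).mul_mem (const_mem 2) (h _)
  · exact h _
  · exact h _

theorem orbitMap_mul_inv_of_mem [CharZero k] (g : SOOdd k n) {h : SOOdd k n}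
    (hh : h ∈ soSubgroup k n) : orbitMap (g * h⁻¹) = orbitMap g := by
  rw [orbitMap_eq_iff_mem_soSubgroup]
  simpa using hh

/-- Right invariant regular functions descend along the orbit map. -/
theorem exists_eq_comp_orbitMap [CharZero k] (hn : 0 < n) {F : Subgroup (SOOdd k n)}
    {f : SOOdd k n → k} (hf : f ∈ doubleInvariants k n F (soSubgroup k n)) :
    ∃ b ∈ coordQuadric k n, ∀ g, f g = b (orbitMap g) := by
  -- An arbitrary set-theoretic section suffices: invariance makes its choice irrelevant, and
  -- regularity of `b` follows afterwards from that of its pullback `f`.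
  let b : quadric k n → k := f ∘ Function.surjInv (orbitMap_surjective hn)
  have hb (g : SOOdd k n) : f g = b (orbitMap g) := by
    have h1 := (orbitMap_eq_iff_mem_soSubgroup _ g).1
      (Function.surjInv_eq (orbitMap_surjective hn) (orbitMap g))
    have h2 := hf.2 (1, ⟨_, h1⟩) g
    simpa [b] using h2.symm
  refine ⟨b, mem_coordQuadric_of_comp_orbitMap_mem hn ?_, hb⟩
  rw [show b ∘ orbitMap = f from funext fun g => (hb g).symm]
  exact hf.1

theorem pullbackIso_orbitMap [CharZero k] (hn : 0 < n) :
    PullbackIso (orbitMap : SOOdd k n → quadric k n) (coordQuadric k n)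
      (doubleInvariants k n ⊥ (soSubgroup k n)) := by
  refine pullbackIso_of_surjective (orbitMap_surjective hn)
    (fun f hf => ⟨comp_orbitMap_mem_coordSO hf, ?_⟩) fun f hf => exists_eq_comp_orbitMap hn hf
  rintro ⟨⟨t, ht⟩, h, hh⟩ g
  obtain rfl := Subgroup.mem_bot.1 ht
  change f (orbitMap (1 * g * h⁻¹)) = f (orbitMap g)
  rw [one_mul, orbitMap_mul_inv_of_mem g hh]

theorem pullbackIso_orbitMap_torusInvariants [CharZero k] (hn : 0 < n) :
    PullbackIso (orbitMap : SOOdd k n → quadric k n) (torusInvariantsQuadric k n)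
      (doubleInvariants k n (diagTorus k n) (soSubgroup k n)) := by
  refine pullbackIso_of_surjective (orbitMap_surjective hn)
    (fun f hf => ⟨comp_orbitMap_mem_coordSO hf.1, ?_⟩) fun f hf => ?_
  · rintro ⟨t, h, hh⟩ g
    change f (orbitMap (t * g * h⁻¹)) = f (orbitMap g)
    rw [orbitMap_mul_inv_of_mem _ hh, orbitMap_torus_mul, hf.2]
  · obtain ⟨b, hb, hbf⟩ := exists_eq_comp_orbitMap hn hf
    refine ⟨b, ⟨hb, fun t v => ?_⟩, hbf⟩
    -- Left `T`-invariance of `f` transfers to `b` because every point of the quadric lifts to the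
    -- group and the orbit map is equivariant.
    obtain ⟨g, rfl⟩ := orbitMap_surjective hn v
    have := hf.2 (t, 1) g
    change b (torusActQuadric t (orbitMap g)) = _
    rw [← orbitMap_torus_mul, ← hbf, ← hbf]
    simpa using this

end OrbitMap

theorem mainTheorem7 (k : Type*) [Field k] [IsAlgClosed k] [CharZero k] (n : ℕ) (hn : 0 < n) :
    -- the algebra of invariants of `T × SO_{2n}` on `SO_{2n+1}` is free, on `n` generators
    Nonempty (MvPolynomial (Fin n) k ≃ₐ[k]
      doubleInvariants k n (diagTorus k n) (soSubgroup k n)) ∧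
    -- the orbit map is `T`-equivariant and identifies `SO_{2n+1} / SO_{2n}` with the quadric `Z`
    ((∀ (t : diagTorus k n) (g : SOOdd k n),
        orbitMap ((t : SOOdd k n) * g) = torusActQuadric t (orbitMap g)) ∧
      Function.Surjective (orbitMap : SOOdd k n → quadric k n) ∧
      (∀ g g' : SOOdd k n, orbitMap g = orbitMap g' ↔ g⁻¹ * g' ∈ soSubgroup k n) ∧
      PullbackIso (orbitMap : SOOdd k n → quadric k n) (coordQuadric k n)
        (doubleInvariants k n ⊥ (soSubgroup k n))) ∧
    -- the double coset variety is the torus quotient of `Z`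
    PullbackIso (orbitMap : SOOdd k n → quadric k n) (torusInvariantsQuadric k n)
      (doubleInvariants k n (diagTorus k n) (soSubgroup k n)) ∧
    -- the torus quotient of `Z` is the hypersurface `z₁ + ⋯ + zₙ + x² = 1`
    PullbackIso (torusQuotientMap : quadric k n → parabolicCylinder k n)
      (coordParabolicCylinder k n) (torusInvariantsQuadric k n) ∧
    -- which is a cylinder over a parabola, up to a linear change of coordinates
    (∃ L : (Fin n ⊕ Unit → k) ≃ₗ[k] (k × k) × (Fin (n - 1) → k),
      L '' parabolicCylinder k n = parabola k ×ˢ Set.univ) ∧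
    -- and hence an affine space
    (∃ e : (Fin n → k) ≃ parabolicCylinder k n,
      PullbackIso e (coordParabolicCylinder k n) (coordAffineSpace k n)) := by
  have hC := pullbackIso_orbitMap_torusInvariants (k := k) hn
  have hY := pullbackIso_torusQuotientMap (k := k) (n := n)
  obtain ⟨m, rfl⟩ : ∃ m, n = m + 1 := ⟨n - 1, by omega⟩
  have hA := pullbackIso_graphEquiv (k := k) m
  refine ⟨?_, ⟨orbitMap_torus_mul, orbitMap_surjective hn, orbitMap_eq_iff_mem_soSubgroup,
    pullbackIso_orbitMap hn⟩, hC, hY, ⟨sumCoordinate k m, sumCoordinate_image m⟩,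
    graphEquiv k m, hA⟩
  obtain ⟨φ⟩ := nonempty_mvPolynomial_algEquiv_coordAffineSpace (k := k) (m + 1)
  obtain ⟨α, -⟩ := hA
  obtain ⟨β, -⟩ := hY
  obtain ⟨γ, -⟩ := hC
  -- The chain runs from polynomials through `k[𝔸ⁿ]`, `k[Y]` and `k[Z]^T` to the double invariants.
  exact ⟨((φ.trans α.symm).trans β).trans γ⟩
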